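/- Let $\mathbb{F}$ be a field of characteristic different from $2$, let $a,b\in\mathbb{F}\setminus\{0\}$, and let $\mathbb{H}=\mathbb{H}(a,b)$ be the quaternion algebra over $\mathbb{F}$ with basis $1,i,j,k$ and $i^2=a$, $j^2=b$, $ij=k=-ji$ (a division algebra or split), with its conjugation $\overline{x_0+x_1i+x_2j+x_3k}=x_0-x_1i-x_2j-x_3k$. Let $n\ge 1$. For $M=(m_{pq})\in \mathrm{M}(n,\mathbb{H})$, $\sigma\in S_n$ and an index $p$, put $c_p(\sigma)=m_{p\,\sigma(p)}\,m_{\sigma(p)\,\sigma^2(p)}\cdots m_{\sigma^{-1}(p)\,p}$, the ordered product along the cycle of $\sigma$ through $p$. For an index $i$ let $p_2<\dots<p_r$ be the smallest elements of the cycles of $\sigma$ (fixed points included) that do not contain $i$. The $i$-th row and column determinants of $M$ are $$\mathrm{rdet}_i M=\sum_{\sigma\in S_n}(-1)^{n-r}\,c_i(\sigma)\,c_{p_2}(\sigma)\cdots c_{p_r}(\sigma),\qquad \mathrm{cdet}_i M=\sum_{\sigma\in S_n}(-1)^{n-r}\,c_{p_r}(\sigma)\cdots c_{p_2}(\sigma)\,c_i(\sigma).$$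 For a Hermitian matrix all of these coincide; their common value is its determinant $\det$. Let $A^*$ denote the conjugate transpose of $A$, and let $\mathrm{ddet}\,A=\det(AA^*)$ be the double determinant of $A\in\mathrm{M}(n,\mathbb{H})$. Write $M_{.j}(f)$ (resp. $M_{i.}(z)$) for the matrix obtained from $M$ by replacing its $j$-th column by the column $f$ (resp. its $i$-th row by the row $z$). Let $A\in\mathrm{M}(n,\mathbb{H})$ with $\mathrm{ddet}\,A\neq 0$. Then $\mathrm{ddet}\,A$ is a (nonzero) element of $\mathbb{F}$, and: 1. For every column $y\in\mathbb{H}^{n\times 1}$ the right system $Ax=y$ has a unique solution $x=(x_1,\dots,x_n)^T$, and with $f=A^*y$ $$x_j=\frac{\mathrm{cdet}_j\big((A^*A)_{.j}(f)\big)}{\mathrm{ddet}\,A},\qquad j=1,\dots,n.$$ 2. For every row $y\in\mathbb{H}^{1\times n}$ the left system $xA=y$ has a unique solution $x=(x_1,\dots,x_n)$, and with $z=yA^*$ $$x_i=\frac{\mathrm{rdet}_i\big((AA^*)_{i.}(z)\big)}{\mathrm{ddet}\,A},\qquad i=1,\dots,n.$$ -/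

import Mathlib

open scoped Quaternion Matrix

noncomputable section

namespace RowColDet

/-- The ordered product `a_{m, σ m} a_{σ m, σ² m} ⋯ a_{σ⁻¹ m, m}` along the cycle of `σ`
through `m`, read from `m` on (it is `a_{m, m}` if `m` is a fixed point). -/
def cycleProd {n : ℕ} {H : Type*} [Ring H] (A : Matrix (Fin n) (Fin n) H)
    (σ : Equiv.Perm (Fin n)) (m : Fin n) : H :=
  ((List.range (Function.minimalPeriod σ m)).map
    fun t => A ((σ ^ t) m) ((σ ^ (t + 1)) m)).prod

/-- The smallest elements of those cycles of `σ` (fixed points included) that do not contain `i`,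
in increasing order. -/
def leaders {n : ℕ} (σ : Equiv.Perm (Fin n)) (i : Fin n) : List (Fin n) :=
  (List.finRange n).filter fun m => ¬ σ.SameCycle i m ∧ ∀ l, σ.SameCycle m l → m ≤ l

/-- The `i`-th row determinant: in each monomial the cycle through `i` comes first, starting at
`i`; the other cycles follow, each starting at its smallest element, with these smallest elements
increasing from left to right. The sign `(-1)^(n - r)`, where `r` is the number of cycles, is the
sign of the permutation. -/
def rdet {n : ℕ} {H : Type*} [Ring H] (i : Fin n) (A : Matrix (Fin n) (Fin n) H) : H :=
  ∑ σ : Equiv.Perm (Fin n), ((Equiv.Perm.sign σ : ℤˣ) : ℤ) •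
    (cycleProd A σ i * ((leaders σ i).map (cycleProd A σ)).prod)

/-- The `j`-th column determinant: in each monomial, written from right to left, the cycle through
`j` comes first, and its rightmost factor is the one from column `j`; the other cycles follow to
the left, the rightmost factor of each lying in the column indexed by the smallest element of the
cycle, with these smallest elements increasing from right to left:
`a_{j_{k_r} j_{k_r + l_r}} ⋯ a_{j_{k_r + 1} j_{k_r}} ⋯ a_{j j_{k_1 + l_1}} ⋯ a_{j_{k_1} j}`. -/
def cdet {n : ℕ} {H : Type*} [Ring H] (j : Fin n) (A : Matrix (Fin n) (Fin n) H) : H :=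
  ∑ τ : Equiv.Perm (Fin n), ((Equiv.Perm.sign τ : ℤˣ) : ℤ) •
    (((leaders τ j).reverse.map (cycleProd A τ)).prod * cycleProd A τ j)

/-- The determinant of a Hermitian matrix: the common value of all its row and column
determinants, given here by the first row determinant. -/
def hdet {n : ℕ} [NeZero n] {H : Type*} [Ring H] (A : Matrix (Fin n) (Fin n) H) : H :=
  rdet 0 A

/-- The double determinant: the determinant of the Hermitian matrix `A A*`. -/
def ddet {n : ℕ} [NeZero n] {H : Type*} [Ring H] [StarRing H]
    (A : Matrix (Fin n) (Fin n) H) : H :=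
  hdet (A * Aᴴ)

end RowColDet

end

noncomputable section

set_option linter.unusedSectionVars false

namespace RowColDet

open Equiv.Perm Function

section Cycle

variable {ι : Type*} [Finite ι]

theorem minimalPeriod_perm_pos (σ : Equiv.Perm ι) (m : ι) : 0 < minimalPeriod σ m := by
  refine minimalPeriod_pos_of_mem_periodicPts ⟨orderOf σ, orderOf_pos σ, ?_⟩
  rw [IsPeriodicPt, IsFixedPt, iterate_eq_pow, pow_orderOf_eq_one, one_apply]

theorem pow_minimalPeriod_apply (σ : Equiv.Perm ι) (m : ι) :
    (σ ^ minimalPeriod σ m) m = m := by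
  rw [← iterate_eq_pow]
  exact isPeriodicPt_minimalPeriod σ m

theorem pow_apply_ne_of_lt_minimalPeriod {σ : Equiv.Perm ι} {m : ι} {t : ℕ} (h0 : 0 < t)
    (ht : t < minimalPeriod σ m) : (σ ^ t) m ≠ m := by
  intro h
  rw [← iterate_eq_pow] at h
  exact not_isPeriodicPt_of_pos_of_lt_minimalPeriod h0.ne' ht h

theorem minimalPeriod_eq_of_pow {σ : Equiv.Perm ι} {m : ι} {N : ℕ} (h0 : 0 < N)
    (hN : (σ ^ N) m = m) (h : ∀ t, 0 < t → t < N → (σ ^ t) m ≠ m) :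
    minimalPeriod σ m = N := by
  refine le_antisymm ?_ ?_
  · refine IsPeriodicPt.minimalPeriod_le h0 ?_
    rw [IsPeriodicPt, IsFixedPt, iterate_eq_pow, hN]
  · by_contra hlt
    exact h _ (minimalPeriod_perm_pos σ m) (not_le.mp hlt) (pow_minimalPeriod_apply σ m)

theorem exists_pow_lt_minimalPeriod {σ : Equiv.Perm ι} {m p : ι} (h : σ.SameCycle m p) :
    ∃ t < minimalPeriod σ m, (σ ^ t) m = p := by
  obtain ⟨t, -, ht⟩ := h.exists_pow_eq'
  refine ⟨t % minimalPeriod σ m, Nat.mod_lt _ (minimalPeriod_perm_pos σ m), ?_⟩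
  rw [← iterate_eq_pow, iterate_mod_minimalPeriod_eq, iterate_eq_pow, ht]

theorem minimalPeriod_perm_congr {σ τ : Equiv.Perm ι} {m : ι}
    (h : ∀ t : ℕ, (σ ^ t) m = (τ ^ t) m) : minimalPeriod σ m = minimalPeriod τ m := by
  refine minimalPeriod_eq_of_pow (minimalPeriod_perm_pos τ m) ?_ fun t h0 ht => ?_
  · rw [h, pow_minimalPeriod_apply]
  · rw [h]
    exact pow_apply_ne_of_lt_minimalPeriod h0 ht

theorem sameCycle_of_forall_sameCycle_apply {σ τ : Equiv.Perm ι}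
    (h : ∀ x, σ.SameCycle x (τ x)) {x y : ι} (hxy : τ.SameCycle x y) : σ.SameCycle x y := by
  obtain ⟨t, -, rfl⟩ := hxy.exists_pow_eq'
  clear hxy
  induction t with
  | zero => exact SameCycle.refl _ _
  | succ t ih =>
    rw [pow_succ', mul_apply]
    exact ih.trans (h _)

/-- The ordered product of the entries of `M` along the cycle of `σ` through `m`, read from `m`
on, for an arbitrary index type. -/
def cyc {H : Type*} [Ring H] (M : Matrix ι ι H) (σ : Equiv.Perm ι) (m : ι) : H :=
  ((List.range (minimalPeriod σ m)).map fun t => M ((σ ^ t) m) ((σ ^ (t + 1)) m)).prod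

variable {H : Type*} [Ring H]

theorem cyc_congr {M M' : Matrix ι ι H} {σ τ : Equiv.Perm ι} {m : ι}
    (hp : ∀ t : ℕ, (σ ^ t) m = (τ ^ t) m)
    (hM : ∀ p, σ.SameCycle m p → M p (σ p) = M' p (σ p)) : cyc M σ m = cyc M' τ m := by
  rw [cyc, cyc, minimalPeriod_perm_congr hp]
  congr 1
  refine List.map_congr_left fun t _ => ?_
  rw [← hp, ← hp, pow_succ', mul_apply]
  exact hM _ (sameCycle_pow_right.mpr (SameCycle.refl _ _))

/-- The product of the entries of `M` along the cycle through `m` after the first one. -/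
def cycTail (M : Matrix ι ι H) (σ : Equiv.Perm ι) (m : ι) : H :=
  ((List.range (minimalPeriod σ m - 1)).map
    fun t => M ((σ ^ (t + 1)) m) ((σ ^ (t + 2)) m)).prod

theorem cyc_eq_mul_cycTail (M : Matrix ι ι H) (σ : Equiv.Perm ι) (m : ι) :
    cyc M σ m = M m (σ m) * cycTail M σ m := by
  obtain ⟨N, hN⟩ := Nat.exists_eq_succ_of_ne_zero (minimalPeriod_perm_pos σ m).ne'
  rw [cyc, cycTail, hN, List.range_succ_eq_map]
  simp [List.map_map, Function.comp_def]

theorem cyc_apply_eq_cycTail_mul (M : Matrix ι ι H) (σ : Equiv.Perm ι) (m : ι) :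
    cyc M σ (σ m) = cycTail M σ m * M m (σ m) := by
  have hper : minimalPeriod σ (σ m) = minimalPeriod σ m := by
    refine minimalPeriod_eq_of_pow (minimalPeriod_perm_pos σ m) ?_ fun t h0 ht h => ?_
    · rw [← mul_apply, ← pow_succ, pow_succ', mul_apply, pow_minimalPeriod_apply]
    · rw [← mul_apply, ← pow_succ, pow_succ', mul_apply] at h
      exact pow_apply_ne_of_lt_minimalPeriod h0 ht (σ.injective h)
  have hs : ∀ t : ℕ, (σ ^ t) (σ m) = (σ ^ (t + 1)) m := fun t => by
    rw [pow_succ, mul_apply]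
  obtain ⟨N, hN⟩ := Nat.exists_eq_succ_of_ne_zero (minimalPeriod_perm_pos σ m).ne'
  have hNm := pow_minimalPeriod_apply σ m
  rw [cyc, cycTail, hper, hN, List.range_succ]
  rw [hN, Nat.succ_eq_add_one] at hNm
  simp only [hs, List.map_append, List.prod_append, List.map_cons, List.map_nil, List.prod_cons,
    List.prod_nil, mul_one, hNm, Nat.succ_eq_add_one, Nat.add_sub_cancel]
  rw [pow_succ' σ (N + 1), mul_apply, hNm]

theorem cycTail_congr {M M' : Matrix ι ι H} {σ : Equiv.Perm ι} {m : ι}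
    (hM : ∀ p, p ≠ m → M p = M' p) : cycTail M σ m = cycTail M' σ m := by
  rw [cycTail, cycTail]
  congr 1
  refine List.map_congr_left fun t ht => ?_
  rw [hM]
  refine pow_apply_ne_of_lt_minimalPeriod (by omega) ?_
  have := List.mem_range.mp ht
  omega

theorem cyc_eq_zero_of_entry {M : Matrix ι ι H} {σ : Equiv.Perm ι} {m p : ι}
    (h : σ.SameCycle m p) (hp : M p (σ p) = 0) : cyc M σ m = 0 := by
  obtain ⟨t, ht, rfl⟩ := exists_pow_lt_minimalPeriod h
  refine List.prod_eq_zero ?_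
  rw [List.mem_map]
  refine ⟨t, List.mem_range.mpr ht, ?_⟩
  rw [pow_succ', mul_apply, hp]

theorem cyc_of_apply_eq {M : Matrix ι ι H} {σ : Equiv.Perm ι} {m : ι} (h : σ m = m) :
    cyc M σ m = M m m := by
  have : minimalPeriod σ m = 1 := minimalPeriod_eq_of_pow one_pos (by simpa using h)
    (by intros; omega)
  rw [cyc, this]
  simp [h]

theorem minimalPeriod_perm_inv (σ : Equiv.Perm ι) (m : ι) :
    minimalPeriod (σ⁻¹ : Equiv.Perm ι) m = minimalPeriod σ m := by
  refine minimalPeriod_eq_of_pow (minimalPeriod_perm_pos σ m) ?_ fun t h0 ht h => ?_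
  · rw [inv_pow, inv_eq_iff_eq, pow_minimalPeriod_apply]
  · rw [inv_pow, inv_eq_iff_eq] at h
    exact pow_apply_ne_of_lt_minimalPeriod h0 ht h.symm

theorem star_prod_map_range [StarRing H] (f : ℕ → H) (N : ℕ) :
    star ((List.range N).map f).prod =
      ((List.range N).map fun t => star (f (N - 1 - t))).prod := by
  induction N with
  | zero => simp
  | succ N ih =>
    rw [List.range_succ, List.map_append, List.prod_append, star_mul, ih, ← List.range_succ,
      List.range_succ_eq_map]
    simp only [List.map_cons, List.map_nil, List.prod_cons, List.prod_nil, mul_one, List.map_map,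
      Nat.add_sub_cancel, Nat.sub_zero]
    congr 3
    funext t
    simp [Nat.sub_sub, add_comm]

theorem star_cyc [StarRing H] (M : Matrix ι ι H) (σ : Equiv.Perm ι) (m : ι) :
    star (cyc M σ m) = cyc Mᴴ σ⁻¹ m := by
  rw [cyc, cyc, minimalPeriod_perm_inv, star_prod_map_range]
  congr 1
  refine List.map_congr_left fun t ht => ?_
  have hN := pow_minimalPeriod_apply σ m
  generalize minimalPeriod σ m = N at *
  have ht := List.mem_range.mp ht
  have key : ∀ s, s ≤ N → (σ⁻¹ ^ s) m = (σ ^ (N - s)) m := fun s hs => by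
    rw [inv_pow, inv_eq_iff_eq, ← mul_apply, ← pow_add, Nat.add_sub_cancel' hs, hN]
  rw [key t ht.le, key (t + 1) ht, Matrix.conjTranspose_apply,
    show N - (t + 1) = N - 1 - t by omega, show N - 1 - t + 1 = N - t by omega]

end Cycle

section Reverse

variable {ι : Type*} [Finite ι]

open Classical in
/-- The permutation obtained from `σ` by reversing its cycle through `k`. -/
def revCycle (σ : Equiv.Perm ι) (k : ι) : Equiv.Perm ι where
  toFun x := if σ.SameCycle k x then σ⁻¹ x else σ x
  invFun x := if σ.SameCycle k x then σ x else σ⁻¹ x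
  left_inv x := by by_cases h : σ.SameCycle k x <;> simp [h]
  right_inv x := by by_cases h : σ.SameCycle k x <;> simp [h]

theorem revCycle_apply_of_sameCycle {σ : Equiv.Perm ι} {k x : ι} (h : σ.SameCycle k x) :
    revCycle σ k x = σ⁻¹ x := if_pos h

theorem revCycle_apply_of_not_sameCycle {σ : Equiv.Perm ι} {k x : ι} (h : ¬ σ.SameCycle k x) :
    revCycle σ k x = σ x := if_neg h

theorem sameCycle_revCycle {σ : Equiv.Perm ι} {k x y : ι} :
    (revCycle σ k).SameCycle x y ↔ σ.SameCycle x y := by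
  refine ⟨sameCycle_of_forall_sameCycle_apply fun x => ?_,
    sameCycle_of_forall_sameCycle_apply fun x => ?_⟩
  · by_cases h : σ.SameCycle k x
    · rw [revCycle_apply_of_sameCycle h]
      exact sameCycle_symm_apply_right.mpr (SameCycle.refl _ _)
    · rw [revCycle_apply_of_not_sameCycle h]
      exact sameCycle_apply_right.mpr (SameCycle.refl _ _)
  · by_cases h : σ.SameCycle k x
    · have h' : revCycle σ k (σ x) = x := by
        rw [revCycle_apply_of_sameCycle (sameCycle_apply_right.mpr h), inv_def,
          Equiv.symm_apply_apply]
      have : (revCycle σ k).SameCycle (σ x) (revCycle σ k (σ x)) :=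
        sameCycle_apply_right.mpr (SameCycle.refl _ _)
      rw [h'] at this
      exact this.symm
    · rw [← revCycle_apply_of_not_sameCycle h]
      exact sameCycle_apply_right.mpr (SameCycle.refl _ _)

theorem revCycle_revCycle (σ : Equiv.Perm ι) (k : ι) : revCycle (revCycle σ k) k = σ := by
  ext x
  by_cases h : σ.SameCycle k x
  · rw [revCycle_apply_of_sameCycle (sameCycle_revCycle.mpr h), inv_eq_iff_eq,
      revCycle_apply_of_sameCycle (sameCycle_apply_right.mpr h), inv_def, Equiv.symm_apply_apply]
  · rw [revCycle_apply_of_not_sameCycle (by rwa [sameCycle_revCycle]),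
      revCycle_apply_of_not_sameCycle h]

theorem revCycle_pow_apply_of_sameCycle {σ : Equiv.Perm ι} {k x : ι} (h : σ.SameCycle k x)
    (t : ℕ) : (revCycle σ k ^ t) x = (σ⁻¹ ^ t) x := by
  induction t with
  | zero => simp
  | succ t ih =>
    rw [pow_succ', mul_apply, ih, pow_succ', mul_apply, revCycle_apply_of_sameCycle]
    rw [← sameCycle_inv] at h ⊢
    exact sameCycle_pow_right.mpr h

theorem revCycle_pow_apply_of_not_sameCycle {σ : Equiv.Perm ι} {k x : ι}
    (h : ¬ σ.SameCycle k x) (t : ℕ) : (revCycle σ k ^ t) x = (σ ^ t) x := by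
  induction t with
  | zero => simp
  | succ t ih =>
    rw [pow_succ', mul_apply, ih, pow_succ', mul_apply, revCycle_apply_of_not_sameCycle]
    simpa using h

theorem sign_revCycle {ι : Type*} [Fintype ι] [DecidableEq ι] (σ : Equiv.Perm ι) (k : ι) :
    sign (revCycle σ k) = sign σ := by
  have h : revCycle σ k = σ * ((cycleOf σ⁻¹ k) * (cycleOf σ⁻¹ k)) := by
    ext x
    by_cases h : σ⁻¹.SameCycle k x
    · rw [revCycle_apply_of_sameCycle (sameCycle_inv.mp h), mul_apply, mul_apply,
        SameCycle.cycleOf_apply h, SameCycle.cycleOf_apply (sameCycle_apply_right.mpr h),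
        ← mul_apply σ, mul_inv_cancel, one_apply]
    · rw [revCycle_apply_of_not_sameCycle (by rwa [sameCycle_inv] at h), mul_apply, mul_apply,
        cycleOf_apply_of_not_sameCycle h, cycleOf_apply_of_not_sameCycle h]
  rw [h, map_mul, map_mul, Int.units_mul_self, mul_one]

variable {H : Type*} [Ring H]

theorem cyc_revCycle_of_not_sameCycle (M : Matrix ι ι H) {σ : Equiv.Perm ι} {k p : ι}
    (h : ¬ σ.SameCycle k p) : cyc M (revCycle σ k) p = cyc M σ p :=
  cyc_congr (revCycle_pow_apply_of_not_sameCycle h) fun _ _ => rfl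

theorem cyc_revCycle_of_sameCycle [StarRing H] {M : Matrix ι ι H} {σ : Equiv.Perm ι} {k p : ι}
    (hM : ∀ p q, σ.SameCycle k p → σ.SameCycle k q → star (M p q) = M q p)
    (h : σ.SameCycle k p) : cyc M (revCycle σ k) p = star (cyc M σ p) := by
  rw [star_cyc]
  refine cyc_congr (revCycle_pow_apply_of_sameCycle h) fun q hq => ?_
  have hq := h.trans (sameCycle_revCycle.mp hq)
  rw [Matrix.conjTranspose_apply, hM _ _ _ hq]
  rw [← sameCycle_revCycle (k := k)] at hq ⊢
  simpa using hq

end Reverse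

section Swap

variable {ι : Type*} [Finite ι] [DecidableEq ι] {H : Type*} [Ring H]

theorem mul_swap_pow_apply_of_not_sameCycle {σ : Equiv.Perm ι} {i k p : ι}
    (hi : ¬ σ.SameCycle i p) (hk : ¬ σ.SameCycle k p) (t : ℕ) :
    ((σ * Equiv.swap i k) ^ t) p = (σ ^ t) p := by
  induction t with
  | zero => simp
  | succ t ih =>
    rw [pow_succ', mul_apply, ih, pow_succ', mul_apply, mul_apply, Equiv.swap_apply_of_ne_of_ne]
    · rintro rfl
      exact hi (sameCycle_pow_left.mpr (SameCycle.refl _ _))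
    · rintro rfl
      exact hk (sameCycle_pow_left.mpr (SameCycle.refl _ _))

/-- As long as the orbit of `k` under `σ` avoids `i` and `k`, the orbit of `i` under
`σ * swap i k` follows it. -/
theorem mul_swap_pow_succ_apply {σ : Equiv.Perm ι} {i k : ι} (t : ℕ)
    (h : ∀ s, 0 < s → s ≤ t → (σ ^ s) k ≠ i ∧ (σ ^ s) k ≠ k) :
    ((σ * Equiv.swap i k) ^ (t + 1)) i = (σ ^ (t + 1)) k := by
  induction t with
  | zero => simp
  | succ t ih =>
    rw [pow_succ', mul_apply, ih fun s h0 hs => h s h0 (by omega), mul_apply,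
      Equiv.swap_apply_of_ne_of_ne (h _ (by omega) le_rfl).1 (h _ (by omega) le_rfl).2,
      pow_succ' σ (t + 1), mul_apply]

theorem mul_swap_pow_apply {σ : Equiv.Perm ι} {i k : ι} (hik : ¬ σ.SameCycle i k) {t : ℕ}
    (h0 : 0 < t) (ht : t ≤ minimalPeriod σ k) :
    ((σ * Equiv.swap i k) ^ t) i = (σ ^ t) k := by
  obtain ⟨t, rfl⟩ := Nat.exists_eq_succ_of_ne_zero h0.ne'
  refine mul_swap_pow_succ_apply t fun s h0 hs => ⟨?_, ?_⟩
  · rintro rfl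
    exact hik (sameCycle_pow_left.mpr (SameCycle.refl _ _))
  · exact pow_apply_ne_of_lt_minimalPeriod h0 (by omega)

theorem mul_swap_pow_minimalPeriod_apply {σ : Equiv.Perm ι} {i k : ι}
    (hik : ¬ σ.SameCycle i k) :
    ((σ * Equiv.swap i k) ^ minimalPeriod σ k) i = k := by
  rw [mul_swap_pow_apply hik (minimalPeriod_perm_pos σ k) le_rfl, pow_minimalPeriod_apply]

theorem mul_swap_pow_add_apply {σ : Equiv.Perm ι} {i k : ι} (hik : ¬ σ.SameCycle i k) {t : ℕ}
    (h0 : 0 < t) (ht : t ≤ minimalPeriod σ i) :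
    ((σ * Equiv.swap i k) ^ (minimalPeriod σ k + t)) i = (σ ^ t) i := by
  rw [add_comm, pow_add, mul_apply, mul_swap_pow_minimalPeriod_apply hik, Equiv.swap_comm,
    mul_swap_pow_apply (fun h => hik h.symm) h0 ht]

theorem sameCycle_mul_swap_of_not_sameCycle {σ : Equiv.Perm ι} {i k : ι}
    (hik : ¬ σ.SameCycle i k) : (σ * Equiv.swap i k).SameCycle i k :=
  ⟨minimalPeriod σ k, by rw [zpow_natCast, mul_swap_pow_minimalPeriod_apply hik]⟩

theorem sameCycle_of_sameCycle_mul_swap {σ : Equiv.Perm ι} {i k : ι} (hik : σ.SameCycle i k)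
    {x y : ι} (h : (σ * Equiv.swap i k).SameCycle x y) : σ.SameCycle x y := by
  refine sameCycle_of_forall_sameCycle_apply (fun z => ?_) h
  rw [mul_apply, sameCycle_apply_right]
  by_cases hzi : z = i
  · rwa [hzi, Equiv.swap_apply_left]
  by_cases hzk : z = k
  · rw [hzk, Equiv.swap_apply_right]
    exact hik.symm
  rw [Equiv.swap_apply_of_ne_of_ne hzi hzk]

theorem mul_swap_mul_swap (σ : Equiv.Perm ι) (i k : ι) :
    σ * Equiv.swap i k * Equiv.swap i k = σ := by
  rw [mul_assoc, Equiv.swap_mul_self, mul_one]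

theorem not_sameCycle_mul_swap_of_sameCycle {σ : Equiv.Perm ι} {i k : ι} (hne : i ≠ k)
    (hik : σ.SameCycle i k) : ¬ (σ * Equiv.swap i k).SameCycle i k := by
  obtain ⟨t, ht, htk⟩ := exists_pow_lt_minimalPeriod hik
  have ht0 : 0 < t := by
    rcases Nat.eq_zero_or_pos t with rfl | h
    · exact absurd (by simpa using htk) hne
    · exact h
  have hinj : ∀ s, 0 < s → s < t → (σ ^ s) i ≠ i ∧ (σ ^ s) i ≠ k := fun s h0 hs => by
    refine ⟨pow_apply_ne_of_lt_minimalPeriod h0 (hs.trans ht), fun h => ?_⟩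
    rw [← htk, ← Nat.add_sub_cancel' hs.le, pow_add, mul_apply, EmbeddingLike.apply_eq_iff_eq] at h
    exact pow_apply_ne_of_lt_minimalPeriod (by omega) (by omega) h.symm
  have horb : ∀ s, 0 < s → s ≤ t → ((σ * Equiv.swap i k) ^ s) k = (σ ^ s) i := fun s h0 hs => by
    obtain ⟨s, rfl⟩ := Nat.exists_eq_succ_of_ne_zero h0.ne'
    rw [Equiv.swap_comm]
    exact mul_swap_pow_succ_apply s fun u h0 hu => (hinj u h0 (by omega)).symm
  have hper : minimalPeriod (σ * Equiv.swap i k : Equiv.Perm ι) k = t :=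
    minimalPeriod_eq_of_pow ht0 (by rw [horb t ht0 le_rfl, htk]) fun s h0 hs => by
      rw [horb s h0 hs.le]
      exact (hinj s h0 hs).2
  intro h
  obtain ⟨s, hs, hsi⟩ := exists_pow_lt_minimalPeriod h.symm
  rw [hper] at hs
  rcases Nat.eq_zero_or_pos s with rfl | h0
  · exact hne (by simpa using hsi.symm)
  · rw [horb s h0 hs.le] at hsi
    exact (hinj s h0 hs).1 hsi

theorem sameCycle_mul_swap_iff {σ : Equiv.Perm ι} {i k : ι} (hik : ¬ σ.SameCycle i k) (p : ι) :
    (σ * Equiv.swap i k).SameCycle i p ↔ σ.SameCycle i p ∨ σ.SameCycle k p := by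
  have h1 := sameCycle_mul_swap_of_not_sameCycle hik
  constructor
  · intro h
    by_contra! hcon
    obtain ⟨t, -, ht⟩ := h.symm.exists_pow_eq'
    rw [mul_swap_pow_apply_of_not_sameCycle hcon.1 hcon.2] at ht
    exact hcon.1 (SameCycle.symm ⟨t, by rwa [zpow_natCast]⟩)
  · have key : ∀ {x y}, σ.SameCycle x y → (σ * Equiv.swap i k).SameCycle x y := fun {x y} h => by
      rw [← mul_swap_mul_swap σ i k] at h
      exact sameCycle_of_sameCycle_mul_swap h1 h
    rintro (h | h)
    · exact key h
    · exact h1.trans (key h)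

theorem sameCycle_mul_swap_iff_of_not_sameCycle {σ : Equiv.Perm ι} {i k p : ι}
    (hi : ¬ σ.SameCycle i p) (hk : ¬ σ.SameCycle k p) (q : ι) :
    (σ * Equiv.swap i k).SameCycle p q ↔ σ.SameCycle p q := by
  constructor
  · intro h
    obtain ⟨t, -, ht⟩ := h.exists_pow_eq'
    exact ⟨t, by rw [zpow_natCast, ← ht, mul_swap_pow_apply_of_not_sameCycle hi hk]⟩
  · intro h
    obtain ⟨t, -, ht⟩ := h.exists_pow_eq'
    exact ⟨t, by rw [zpow_natCast, ← ht, mul_swap_pow_apply_of_not_sameCycle hi hk]⟩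

theorem cyc_mul_swap {M : Matrix ι ι H} {σ : Equiv.Perm ι} {i k : ι}
    (hik : ¬ σ.SameCycle i k) (hM : M i = M k) :
    cyc M (σ * Equiv.swap i k) i = cyc M σ k * cyc M σ i := by
  have hk0 := minimalPeriod_perm_pos σ k
  have hi0 := minimalPeriod_perm_pos σ i
  have hper : minimalPeriod (σ * Equiv.swap i k : Equiv.Perm ι) i =
      minimalPeriod σ k + minimalPeriod σ i := by
    refine minimalPeriod_eq_of_pow (by omega) ?_ fun t h0 ht => ?_
    · rw [mul_swap_pow_add_apply hik hi0 le_rfl, pow_minimalPeriod_apply]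
    · rcases le_or_gt t (minimalPeriod σ k) with h | h
      · rw [mul_swap_pow_apply hik h0 h]
        rintro h
        exact hik (SameCycle.symm ⟨t, by rwa [zpow_natCast]⟩)
      · obtain ⟨s, rfl⟩ := Nat.exists_eq_add_of_le h.le
        rw [mul_swap_pow_add_apply hik (by omega) (by omega)]
        exact pow_apply_ne_of_lt_minimalPeriod (by omega) (by omega)
  rw [cyc, hper, List.range_add, List.map_append, List.prod_append, cyc, cyc, List.map_map]
  congr 2
  · refine List.map_congr_left fun t ht => ?_
    have ht := List.mem_range.mp ht
    rw [mul_swap_pow_apply hik (by omega) ht]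
    rcases Nat.eq_zero_or_pos t with rfl | h0
    · simp [hM]
    · rw [mul_swap_pow_apply hik h0 ht.le]
  · refine List.map_congr_left fun t ht => ?_
    have ht := List.mem_range.mp ht
    rw [comp_apply, add_assoc, mul_swap_pow_add_apply hik (by omega) ht]
    rcases Nat.eq_zero_or_pos t with rfl | h0
    · rw [add_zero, mul_swap_pow_minimalPeriod_apply hik, ← hM, pow_zero, one_apply]
    · rw [mul_swap_pow_add_apply hik h0 ht.le]

end Swap

section Quaternion

variable {F : Type*} [Field F] {a b : F}

theorem re_mul_comm (x y : ℍ[F, a, b]) : (x * y).re = (y * x).re := by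
  simp only [QuaternionAlgebra.re_mul]
  ring

theorem re_star_eq (x : ℍ[F, a, b]) : (star x).re = x.re := by simp

theorem self_add_star_eq (x : ℍ[F, a, b]) :
    x + star x = algebraMap F ℍ[F, a, b] x.re + algebraMap F ℍ[F, a, b] x.re := by
  rw [QuaternionAlgebra.self_add_star', zero_mul, add_zero, two_mul, ← map_add]
  rfl

theorem star_algebraMap_eq (r : F) :
    star (algebraMap F ℍ[F, a, b] r) = algebraMap F ℍ[F, a, b] r :=
  QuaternionAlgebra.star_coe r

theorem eq_of_add_self_eq (h2 : (2 : F) ≠ 0) {x y : ℍ[F, a, b]} (h : x + x = y + y) : x = y := by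
  rw [← two_smul F x, ← two_smul F y] at h
  exact smul_right_injective _ h2 h

/-- Averaging over an involution under which the middle factor is conjugated replaces that factor
by its scalar part. -/
theorem sum_mul_mul_eq_sum_re (h2 : (2 : F) ≠ 0) {α : Type*} (T : Finset α) (e : α → α)
    (he : ∀ s, e (e s) = s) (heT : ∀ s ∈ T, e s ∈ T) (L c R : α → ℍ[F, a, b])
    (hL : ∀ s ∈ T, L (e s) = L s) (hR : ∀ s ∈ T, R (e s) = R s)
    (hc : ∀ s ∈ T, c (e s) = star (c s)) :
    ∑ s ∈ T, L s * c s * R s = ∑ s ∈ T, L s * algebraMap F ℍ[F, a, b] (c s).re * R s := by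
  have h : ∑ s ∈ T, L s * c s * R s = ∑ s ∈ T, L s * star (c s) * R s := by
    refine Finset.sum_nbij' e e heT heT (fun s _ => he s) (fun s _ => he s) fun s hs => ?_
    rw [hL s hs, hR s hs, hc s hs, star_star]
  apply eq_of_add_self_eq h2
  nth_rewrite 2 [h]
  rw [← Finset.sum_add_distrib, ← Finset.sum_add_distrib]
  refine Finset.sum_congr rfl fun s _ => ?_
  rw [← add_mul, ← mul_add, self_add_star_eq, mul_add, add_mul]

end Quaternion

section Leader

variable {ι : Type*} [Fintype ι] [LinearOrder ι]

/-- `p` is the smallest element of its cycle. -/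
def IsLead (σ : Equiv.Perm ι) (p : ι) : Prop := ∀ l, σ.SameCycle p l → p ≤ l

theorem IsLead.eq_of_sameCycle {σ : Equiv.Perm ι} {p q : ι} (hp : IsLead σ p) (hq : IsLead σ q)
    (h : σ.SameCycle p q) : p = q :=
  le_antisymm (hp q h) (hq p h.symm)

theorem exists_isLead (σ : Equiv.Perm ι) (m : ι) : ∃ p, IsLead σ p ∧ σ.SameCycle m p := by
  classical
  obtain ⟨p, hp, hmin⟩ := (Finset.univ.filter fun p => σ.SameCycle m p).exists_minimal
    ⟨m, by simpa using SameCycle.refl σ m⟩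
  rw [Finset.mem_filter] at hp
  refine ⟨p, fun l hl => ?_, hp.2⟩
  rcases le_total p l with h | h
  · exact h
  · exact hmin (by simpa using hp.2.trans hl) h

theorem isLead_congr {σ τ : Equiv.Perm ι} {p : ι}
    (h : ∀ q, σ.SameCycle p q ↔ τ.SameCycle p q) : IsLead σ p ↔ IsLead τ p := by
  simp only [IsLead, h]

theorem isLead_revCycle {σ : Equiv.Perm ι} {k p : ι} :
    IsLead (revCycle σ k) p ↔ IsLead σ p :=
  isLead_congr fun _ => sameCycle_revCycle

end Leader

section Moore

variable {ι : Type*} [Fintype ι] [LinearOrder ι] {F : Type*} [Field F] {a b : F}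

theorem re_cyc_eq_of_sameCycle (M : Matrix ι ι ℍ[F, a, b]) {σ : Equiv.Perm ι} {m p : ι}
    (h : σ.SameCycle m p) : (cyc M σ m).re = (cyc M σ p).re := by
  obtain ⟨t, -, rfl⟩ := h.exists_pow_eq'
  clear h
  induction t with
  | zero => simp
  | succ t ih =>
    rw [ih, pow_succ', mul_apply, cyc_apply_eq_cycTail_mul, cyc_eq_mul_cycTail, re_mul_comm]

open Classical in
/-- The scalar part of the cycle product if `p` is the smallest element of a cycle of `σ` that
avoids `i`, and `1` otherwise. -/
def leadFactor (M : Matrix ι ι ℍ[F, a, b]) (σ : Equiv.Perm ι) (i p : ι) : F :=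
  if IsLead σ p ∧ ¬ σ.SameCycle i p then (cyc M σ p).re else 1

open Classical in
/-- The product of the scalar parts of all cycle products of `σ`. -/
def cyclesRe (M : Matrix ι ι ℍ[F, a, b]) (σ : Equiv.Perm ι) : F :=
  ∏ p, if IsLead σ p then (cyc M σ p).re else 1

/-- The Moore determinant, in terms of the scalar parts of the cycle products. -/
def moore (M : Matrix ι ι ℍ[F, a, b]) : F :=
  ∑ σ : Equiv.Perm ι, ((sign σ : ℤˣ) : ℤ) • cyclesRe M σ

/-- The row determinant with the products of all cycles avoiding `i` replaced by their scalar
parts. -/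
def mooreRow (i : ι) (M : Matrix ι ι ℍ[F, a, b]) : ℍ[F, a, b] :=
  ∑ σ : Equiv.Perm ι, ((sign σ : ℤˣ) : ℤ) •
    (cyc M σ i * algebraMap F ℍ[F, a, b] (∏ p, leadFactor M σ i p))

theorem leadFactor_revCycle {M : Matrix ι ι ℍ[F, a, b]} {σ : Equiv.Perm ι} {i k : ι}
    (hM : ¬ σ.SameCycle i k → ∀ p q, σ.SameCycle k p → σ.SameCycle k q → star (M p q) = M q p)
    (p : ι) : leadFactor M (revCycle σ k) i p = leadFactor M σ i p := by
  classical
  unfold leadFactor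
  simp only [sameCycle_revCycle, isLead_revCycle]
  by_cases h : IsLead σ p ∧ ¬ σ.SameCycle i p
  · rw [if_pos h, if_pos h]
    by_cases hkp : σ.SameCycle k p
    · have hik : ¬ σ.SameCycle i k := fun h' => h.2 (h'.trans hkp)
      rw [cyc_revCycle_of_sameCycle (hM hik) hkp, re_star_eq]
    · rw [cyc_revCycle_of_not_sameCycle M hkp]
  · rw [if_neg h, if_neg h]

theorem re_cyc_mul_prod_leadFactor (M : Matrix ι ι ℍ[F, a, b]) (σ : Equiv.Perm ι) (i : ι) :
    (cyc M σ i).re * ∏ p, leadFactor M σ i p = cyclesRe M σ := by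
  classical
  obtain ⟨l, hl, hil⟩ := exists_isLead σ i
  rw [re_cyc_eq_of_sameCycle M hil, cyclesRe, ← Finset.mul_prod_erase _ _ (Finset.mem_univ l),
    ← Finset.mul_prod_erase _ (fun p => ite (IsLead σ p) _ _) (Finset.mem_univ l), if_pos hl,
    leadFactor, if_neg (by simp [hil]), one_mul]
  congr 1
  refine Finset.prod_congr rfl fun p hp => ?_
  have hpl := (Finset.mem_erase.mp hp).1
  rw [leadFactor]
  refine if_congr ⟨And.left, fun h => ⟨h, fun h' => hpl ?_⟩⟩ rfl rfl
  exact h.eq_of_sameCycle hl (h'.symm.trans hil)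

theorem mooreRow_eq_moore (h2 : (2 : F) ≠ 0) {M : Matrix ι ι ℍ[F, a, b]} (hM : M.IsHermitian)
    (i : ι) : mooreRow i M = algebraMap F ℍ[F, a, b] (moore M) := by
  have hM' : ∀ p q, star (M p q) = M q p := fun p q => hM.apply q p
  have key := sum_mul_mul_eq_sum_re h2 Finset.univ (fun σ : Equiv.Perm ι => revCycle σ i)
    (fun σ => revCycle_revCycle σ i) (fun _ _ => Finset.mem_univ _)
    (fun σ => (((sign σ : ℤˣ) : ℤ) : ℍ[F, a, b])) (fun σ => cyc M σ i)
    (fun σ => algebraMap F ℍ[F, a, b] (∏ p, leadFactor M σ i p))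
    (fun σ _ => by simp only [sign_revCycle])
    (fun σ _ => by
      simp only [leadFactor_revCycle fun _ p q _ _ => hM' p q])
    (fun σ _ => cyc_revCycle_of_sameCycle (fun p q _ _ => hM' p q) (SameCycle.refl σ i))
  simp only [mooreRow, moore, zsmul_eq_mul, ← mul_assoc]
  rw [key, map_sum]
  refine Finset.sum_congr rfl fun σ _ => ?_
  rw [mul_assoc, ← map_mul, re_cyc_mul_prod_leadFactor, map_mul, map_intCast]

theorem star_mooreRow (i : ι) (M : Matrix ι ι ℍ[F, a, b]) :
    star (mooreRow i M) = mooreRow i Mᴴ := by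
  classical
  simp only [mooreRow, star_sum]
  refine Fintype.sum_equiv (Equiv.inv _) _ _ fun σ => ?_
  have h : ∀ p, leadFactor M σ i p = leadFactor Mᴴ σ⁻¹ i p := fun p => by
    rw [leadFactor, leadFactor, ← star_cyc, re_star_eq]
    have hiff : IsLead σ⁻¹ p ∧ ¬ σ⁻¹.SameCycle i p ↔ IsLead σ p ∧ ¬ σ.SameCycle i p :=
      and_congr (isLead_congr fun _ => sameCycle_inv) (not_congr sameCycle_inv)
    by_cases h : IsLead σ p ∧ ¬ σ.SameCycle i p
    · rw [if_pos h, if_pos (hiff.mpr h)]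
    · rw [if_neg h, if_neg (mt hiff.mp h)]
  simp only [Equiv.inv_apply, sign_inv, ← star_cyc, h, zsmul_eq_mul, star_mul, star_algebraMap_eq,
    star_intCast]
  rw [Int.cast_comm, ← Algebra.commutes]

theorem leadFactor_congr {M M' : Matrix ι ι ℍ[F, a, b]} {i : ι}
    (h : ∀ p, p ≠ i → M p = M' p) (σ : Equiv.Perm ι) (p : ι) :
    leadFactor M σ i p = leadFactor M' σ i p := by
  unfold leadFactor
  split_ifs with hp
  · congr 1
    refine cyc_congr (fun _ => rfl) fun q hq => ?_
    rw [h]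
    rintro rfl
    exact hp.2 hq.symm
  · rfl

theorem mooreRow_updateRow (i : ι) (M : Matrix ι ι ℍ[F, a, b]) (u : ι → ℍ[F, a, b]) :
    mooreRow i (M.updateRow i u) = ∑ σ : Equiv.Perm ι, ((sign σ : ℤˣ) : ℤ) •
      (u (σ i) * (cycTail M σ i * algebraMap F ℍ[F, a, b] (∏ p, leadFactor M σ i p))) := by
  have h : ∀ p, p ≠ i → M.updateRow i u p = M p := fun p hp => Matrix.updateRow_ne hp
  simp only [mooreRow, cyc_eq_mul_cycTail, leadFactor_congr h, cycTail_congr h,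
    Matrix.updateRow_self, mul_assoc]

theorem mooreRow_updateRow_add (i : ι) (M : Matrix ι ι ℍ[F, a, b]) (u v : ι → ℍ[F, a, b]) :
    mooreRow i (M.updateRow i (u + v)) =
      mooreRow i (M.updateRow i u) + mooreRow i (M.updateRow i v) := by
  simp only [mooreRow_updateRow, Pi.add_apply, add_mul, smul_add, Finset.sum_add_distrib]

theorem mooreRow_updateRow_smul (i : ι) (M : Matrix ι ι ℍ[F, a, b]) (c : ℍ[F, a, b])
    (u : ι → ℍ[F, a, b]) :
    mooreRow i (M.updateRow i (c • u)) = c * mooreRow i (M.updateRow i u) := by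
  simp only [mooreRow_updateRow, Pi.smul_apply, smul_eq_mul, mul_assoc, Finset.mul_sum,
    mul_smul_comm]

theorem mooreRow_updateRow_sum (i : ι) (M : Matrix ι ι ℍ[F, a, b]) {κ : Type*} (s : Finset κ)
    (c : κ → ℍ[F, a, b]) (u : κ → ι → ℍ[F, a, b]) :
    mooreRow i (M.updateRow i (∑ k ∈ s, c k • u k)) =
      ∑ k ∈ s, c k * mooreRow i (M.updateRow i (u k)) := by
  classical
  induction s using Finset.induction_on with
  | empty => simp [mooreRow_updateRow]
  | insert k s hk ih =>
    rw [Finset.sum_insert hk, Finset.sum_insert hk, mooreRow_updateRow_add,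
      mooreRow_updateRow_smul, ih]

/-- Replacing row `i` of a Hermitian matrix by another of its rows annihilates the row
determinant. -/
theorem mooreRow_updateRow_eq_zero (h2 : (2 : F) ≠ 0) {M : Matrix ι ι ℍ[F, a, b]}
    (hM : M.IsHermitian) {i k : ι} (hik : k ≠ i) : mooreRow i (M.updateRow i (M k)) = 0 := by
  classical
  have hM' : ∀ p q, star (M p q) = M q p := fun p q => hM.apply q p
  set N := M.updateRow i (M k) with hN
  have hrow : N i = N k := by rw [hN, Matrix.updateRow_self, Matrix.updateRow_ne hik]
  have hNi : ∀ p q, p ≠ i → q ≠ i → star (N p q) = N q p := fun p q hp hq => by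
    rw [hN, Matrix.updateRow_ne hp, Matrix.updateRow_ne hq, hM']
  let T : Finset (Equiv.Perm ι) := Finset.univ.filter fun σ => ¬ σ.SameCycle i k
  let ρ : Equiv.Perm ι → F := fun σ =>
    ∏ p, if IsLead σ p ∧ ¬ σ.SameCycle i p ∧ ¬ σ.SameCycle k p then (cyc N σ p).re else 1
  have hT : ∀ {σ}, σ ∈ T ↔ ¬ σ.SameCycle i k := by simp [T]
  have hlead : ∀ σ ∈ T, ∏ p, leadFactor N σ i p = (cyc N σ k).re * ρ σ := fun σ hσ => by
    have hσ := hT.mp hσ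
    obtain ⟨l, hl, hkl⟩ := exists_isLead σ k
    have hil : ¬ σ.SameCycle i l := fun h => hσ (h.trans hkl.symm)
    simp only [ρ]
    rw [re_cyc_eq_of_sameCycle N hkl, ← Finset.mul_prod_erase _ _ (Finset.mem_univ l),
      ← Finset.mul_prod_erase _ (fun p => ite (IsLead σ p ∧ _) _ _) (Finset.mem_univ l),
      leadFactor, if_pos ⟨hl, hil⟩, if_neg (by simp [hkl]), one_mul]
    congr 1
    refine Finset.prod_congr rfl fun p hp => ?_
    have hpl := (Finset.mem_erase.mp hp).1
    refine if_congr ⟨fun h => ⟨h.1, h.2, fun h' => hpl ?_⟩, fun h => ⟨h.1, h.2.1⟩⟩ rfl rfl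
    exact h.1.eq_of_sameCycle hl (h'.symm.trans hkl)
  have hswap : ∀ σ ∈ T, ∏ p, leadFactor N (σ * Equiv.swap i k) i p = ρ σ := fun σ hσ => by
    have hσ := hT.mp hσ
    refine Finset.prod_congr rfl fun p _ => ?_
    simp only [leadFactor, sameCycle_mul_swap_iff hσ, not_or]
    by_cases h : ¬ σ.SameCycle i p ∧ ¬ σ.SameCycle k p
    · refine if_congr (and_congr_left' (isLead_congr fun q =>
        sameCycle_mul_swap_iff_of_not_sameCycle h.1 h.2 q)) ?_ rfl
      rw [cyc_congr (M' := N) (mul_swap_pow_apply_of_not_sameCycle h.1 h.2) fun _ _ => rfl]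
    · rw [if_neg fun h' => h h'.2, if_neg fun h' => h h'.2]
  have hsplit : mooreRow i N =
      ∑ σ ∈ T, ((sign σ : ℤˣ) : ℍ[F, a, b]) * algebraMap F ℍ[F, a, b] (cyc N σ k).re *
        (cyc N σ i * algebraMap F ℍ[F, a, b] (ρ σ)) -
      ∑ σ ∈ T, ((sign σ : ℤˣ) : ℍ[F, a, b]) * cyc N σ k *
        (cyc N σ i * algebraMap F ℍ[F, a, b] (ρ σ)) := by
    rw [mooreRow, ← Finset.sum_filter_add_sum_filter_not _ (fun σ => ¬ σ.SameCycle i k),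
      sub_eq_add_neg, ← Finset.sum_neg_distrib]
    congr 1
    · refine Finset.sum_congr rfl fun σ hσ => ?_
      rw [hlead σ hσ, map_mul, zsmul_eq_mul, ← mul_assoc (cyc N σ i),
        ← Algebra.commutes (cyc N σ k).re]
      simp only [mul_assoc]
    · refine Finset.sum_nbij' (fun σ => σ * Equiv.swap i k) (fun σ => σ * Equiv.swap i k)
        ?_ ?_ ?_ ?_ ?_
      · intro σ hσ
        rw [Finset.mem_filter, not_not] at hσ
        exact hT.mpr (not_sameCycle_mul_swap_of_sameCycle hik.symm hσ.2)
      · intro σ hσ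
        rw [Finset.mem_filter, not_not]
        exact ⟨Finset.mem_univ _, sameCycle_mul_swap_of_not_sameCycle (hT.mp hσ)⟩
      · exact fun σ _ => mul_swap_mul_swap σ i k
      · exact fun σ _ => mul_swap_mul_swap σ i k
      · intro σ hσ
        rw [Finset.mem_filter, not_not] at hσ
        have h1 := not_sameCycle_mul_swap_of_sameCycle hik.symm hσ.2
        have h3 := cyc_mul_swap h1 hrow
        rw [mul_swap_mul_swap] at h3
        have h4 := hswap _ (hT.mpr h1)
        rw [mul_swap_mul_swap] at h4
        simp only [h3, h4, map_mul, sign_swap hik.symm, zsmul_eq_mul]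
        simp [mul_assoc]
  have hkT : ∀ σ ∈ T, ∀ p, σ.SameCycle k p → p ≠ i := fun σ hσ p hp h =>
    hT.mp hσ (h ▸ hp.symm)
  have hρ : ∀ σ ∈ T, ρ (revCycle σ k) = ρ σ := fun σ hσ => by
    refine Finset.prod_congr rfl fun p _ => ?_
    simp only [sameCycle_revCycle, isLead_revCycle]
    by_cases h : σ.SameCycle k p
    · rw [if_neg (by simp [h]), if_neg (by simp [h])]
    · rw [cyc_revCycle_of_not_sameCycle N h]
  rw [hsplit, sub_eq_zero]
  symm
  refine sum_mul_mul_eq_sum_re h2 T (fun σ => revCycle σ k) (fun σ => revCycle_revCycle σ k)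
    (fun σ hσ => ?_) _ _ _ (fun σ hσ => ?_) (fun σ hσ => ?_) fun σ hσ => ?_
  · rw [hT, sameCycle_revCycle]
    exact hT.mp hσ
  · rw [sign_revCycle]
  · rw [hρ σ hσ, cyc_revCycle_of_not_sameCycle N fun h => hT.mp hσ h.symm]
  · exact cyc_revCycle_of_sameCycle (fun p q hp hq => hNi p q (hkT σ hσ p hp) (hkT σ hσ q hq))
      (SameCycle.refl σ k)

end Moore

section Congruence

variable {ι : Type*} [Fintype ι] [LinearOrder ι] {F : Type*} [Field F] {a b : F}

theorem one_add_single_mul (M : Matrix ι ι ℍ[F, a, b]) (i k : ι) (c : ℍ[F, a, b]) :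
    (1 + Matrix.single i k c) * M = M.updateRow i (M i + c • M k) := by
  refine Matrix.ext fun p q => ?_
  rw [add_mul, one_mul, Matrix.add_apply]
  by_cases hp : p = i
  · subst hp
    simp
  · rw [Matrix.updateRow_ne hp, Matrix.single_mul_apply_of_ne _ _ _ _ _ hp, add_zero]

theorem moore_one_add_single_conj (h2 : (2 : F) ≠ 0) {M : Matrix ι ι ℍ[F, a, b]}
    (hM : M.IsHermitian) {i k : ι} (hik : k ≠ i) (c : ℍ[F, a, b]) :
    moore ((1 + Matrix.single i k c) * M * (1 + Matrix.single i k c)ᴴ) = moore M := by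
  set P : Matrix ι ι ℍ[F, a, b] := 1 + Matrix.single i k c with hP
  set N := M * Pᴴ with hN
  have hH : (P * M * Pᴴ).IsHermitian := Matrix.isHermitian_mul_mul_conjTranspose P hM
  have hNH : Nᴴ = M.updateRow i (M i + c • M k) := by
    rw [hN, Matrix.conjTranspose_mul, Matrix.conjTranspose_conjTranspose, hM.eq, hP,
      one_add_single_mul]
  have hPN : P * M * Pᴴ = N.updateRow i (N i + c • N k) := by
    rw [Matrix.mul_assoc, ← hN, hP, one_add_single_mul]
  have h1 : mooreRow i Nᴴ = algebraMap F ℍ[F, a, b] (moore M) := by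
    rw [hNH, mooreRow_updateRow_add, mooreRow_updateRow_smul, Matrix.updateRow_eq_self,
      mooreRow_updateRow_eq_zero h2 hM hik, mul_zero, add_zero, mooreRow_eq_moore h2 hM]
  have h3 : mooreRow i (P * M * Pᴴ) = mooreRow i N := by
    have h4 := mooreRow_updateRow_eq_zero h2 hH hik
    rw [hPN, Matrix.updateRow_ne hik, Matrix.updateRow_idem] at h4
    rw [hPN, mooreRow_updateRow_add, mooreRow_updateRow_smul, Matrix.updateRow_eq_self, h4,
      mul_zero, add_zero]
  apply QuaternionAlgebra.algebraMap_injective (c₁ := a) (c₂ := 0) (c₃ := b)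
  rw [← mooreRow_eq_moore h2 hH i, h3, ← Matrix.conjTranspose_conjTranspose N, ← star_mooreRow, h1,
    star_algebraMap_eq]

theorem cyclesRe_eq_zero {M : Matrix ι ι ℍ[F, a, b]} {σ : Equiv.Perm ι} {p : ι}
    (h : M p (σ p) = 0) : cyclesRe M σ = 0 := by
  obtain ⟨l, hl, hpl⟩ := exists_isLead σ p
  refine Finset.prod_eq_zero (Finset.mem_univ l) ?_
  rw [if_pos hl, cyc_eq_zero_of_entry hpl.symm h]
  rfl

theorem cyclesRe_congr {M M' : Matrix ι ι ℍ[F, a, b]} {σ : Equiv.Perm ι}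
    (h : ∀ p, M p (σ p) = M' p (σ p)) : cyclesRe M σ = cyclesRe M' σ := by
  rw [cyclesRe, cyclesRe]
  refine Finset.prod_congr rfl fun p _ => ?_
  rw [cyc_congr (fun _ => rfl) fun q _ => h q]

end Congruence

section Block

variable {κ κ' ι : Type*} [Fintype κ] [Fintype κ'] [Fintype ι] [LinearOrder κ] [DecidableEq κ']
  [LinearOrder ι] {F : Type*} [Field F] {a b : F}

/-- The permutation of `ι ≃ κ ⊕ κ'` that acts on `κ` by `τ` and fixes `κ'`. -/
def extendInl (e : κ ⊕ κ' ≃ ι) (τ : Equiv.Perm κ) : Equiv.Perm ι :=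
  e.permCongr (Equiv.Perm.sumCongr τ 1)

theorem extendInl_inl (e : κ ⊕ κ' ≃ ι) (τ : Equiv.Perm κ) (p : κ) :
    extendInl e τ (e (Sum.inl p)) = e (Sum.inl (τ p)) := by
  simp [extendInl, Equiv.permCongr_apply]

theorem extendInl_inr (e : κ ⊕ κ' ≃ ι) (τ : Equiv.Perm κ) (q : κ') :
    extendInl e τ (e (Sum.inr q)) = e (Sum.inr q) := by
  simp [extendInl, Equiv.permCongr_apply]

theorem extendInl_pow_inl (e : κ ⊕ κ' ≃ ι) (τ : Equiv.Perm κ) (p : κ) (t : ℕ) :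
    (extendInl e τ ^ t) (e (Sum.inl p)) = e (Sum.inl ((τ ^ t) p)) := by
  induction t with
  | zero => simp
  | succ t ih => rw [pow_succ', mul_apply, ih, extendInl_inl, pow_succ', mul_apply]

theorem extendInl_injective (e : κ ⊕ κ' ≃ ι) : Injective (extendInl e) := by
  intro τ τ' h
  ext p
  have h1 := DFunLike.congr_fun h (e (Sum.inl p))
  rw [extendInl_inl, extendInl_inl] at h1
  exact Sum.inl_injective (e.injective h1)

theorem sign_extendInl (e : κ ⊕ κ' ≃ ι) (τ : Equiv.Perm κ) :
    sign (extendInl e τ) = sign τ := by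
  rw [extendInl, sign_permCongr, sign_sumCongr, map_one, mul_one]

theorem sameCycle_extendInl_inl (e : κ ⊕ κ' ≃ ι) (τ : Equiv.Perm κ) (p : κ) (x : ι) :
    (extendInl e τ).SameCycle (e (Sum.inl p)) x ↔ ∃ q, τ.SameCycle p q ∧ e (Sum.inl q) = x := by
  constructor
  · intro h
    obtain ⟨t, -, rfl⟩ := h.exists_pow_eq'
    exact ⟨(τ ^ t) p, sameCycle_pow_right.mpr (SameCycle.refl _ _),
      (extendInl_pow_inl e τ p t).symm⟩
  · rintro ⟨q, h, rfl⟩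
    obtain ⟨t, -, rfl⟩ := h.exists_pow_eq'
    rw [← extendInl_pow_inl]
    exact sameCycle_pow_right.mpr (SameCycle.refl _ _)

theorem exists_extendInl_eq {e : κ ⊕ κ' ≃ ι} {σ : Equiv.Perm ι}
    (h : ∀ q, σ (e (Sum.inr q)) = e (Sum.inr q)) : ∃ τ, extendInl e τ = σ := by
  have hmaps : Set.MapsTo (e.symm.permCongr σ) (Set.range Sum.inl) (Set.range Sum.inl) := by
    rw [perm_mapsTo_inl_iff_mapsTo_inr]
    rintro _ ⟨q, rfl⟩
    exact ⟨q, by simp [Equiv.permCongr_apply, h]⟩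
  obtain ⟨⟨τ, τ'⟩, hτ⟩ := mem_sumCongrHom_range_of_perm_mapsTo_inl hmaps
  have hσ : ∀ x, σ (e x) = e (Equiv.Perm.sumCongr τ τ' x) := fun x => by
    have := DFunLike.congr_fun hτ x
    simp only [sumCongrHom_apply, Equiv.permCongr_apply, Equiv.symm_symm] at this
    rw [this, Equiv.apply_symm_apply]
  refine ⟨τ, ?_⟩
  ext x
  obtain ⟨y, rfl⟩ := e.surjective x
  rcases y with p | q
  · rw [extendInl_inl, hσ]
    simp
  · rw [extendInl_inr, h]

theorem moore_blockDiagonal_neg_one (e : κ ⊕ κ' ≃ ι)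
    (he : ∀ p q, e (Sum.inl p) ≤ e (Sum.inl q) ↔ p ≤ q) (M : Matrix κ κ ℍ[F, a, b]) :
    moore ((Matrix.fromBlocks M 0 0 (-1)).reindex e e) = (-1) ^ Fintype.card κ' * moore M := by
  classical
  set N := (Matrix.fromBlocks M 0 0 (-1)).reindex e e with hN
  rw [moore, moore, Finset.mul_sum]
  symm
  refine Fintype.sum_of_injective (extendInl e) (extendInl_injective e) _ _ ?_ ?_
  · intro σ hσ
    have : ∃ q, σ (e (Sum.inr q)) ≠ e (Sum.inr q) := by
      by_contra! h
      exact hσ (exists_extendInl_eq h)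
    obtain ⟨q, hq⟩ := this
    rw [cyclesRe_eq_zero (p := e (Sum.inr q)), smul_zero]
    obtain ⟨y, hy⟩ := e.surjective (σ (e (Sum.inr q)))
    rw [← hy] at hq ⊢
    rcases y with p | q'
    · simp [hN]
    · have : q ≠ q' := fun h => hq (by rw [h])
      simp [hN, this]
  · intro τ
    rw [sign_extendInl, mul_smul_comm]
    congr 1
    rw [cyclesRe, cyclesRe, ← e.prod_comp, Fintype.prod_sum_type, mul_comm]
    congr 1
    · refine Finset.prod_congr rfl fun p _ => ?_
      have hlead : IsLead (extendInl e τ) (e (Sum.inl p)) ↔ IsLead τ p := by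
        simp only [IsLead, sameCycle_extendInl_inl]
        constructor
        · exact fun h q hq => (he p q).mp (h _ ⟨q, hq, rfl⟩)
        · rintro h _ ⟨q, hq, rfl⟩
          exact (he p q).mpr (h q hq)
      have hcyc : cyc N (extendInl e τ) (e (Sum.inl p)) = cyc M τ p := by
        have hper : minimalPeriod (extendInl e τ) (e (Sum.inl p)) = minimalPeriod τ p := by
          refine minimalPeriod_eq_of_pow (minimalPeriod_perm_pos τ p) ?_ fun t h0 ht h => ?_
          · rw [extendInl_pow_inl, pow_minimalPeriod_apply]
          · rw [extendInl_pow_inl] at h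
            exact pow_apply_ne_of_lt_minimalPeriod h0 ht (Sum.inl_injective (e.injective h))
        rw [cyc, cyc, hper]
        simp [extendInl_pow_inl, hN]
      rw [hcyc]
      exact if_congr hlead.symm rfl rfl
    · rw [Finset.prod_congr rfl (g := fun _ => (-1 : F)), Finset.prod_const, Finset.card_univ]
      intro q _
      rw [if_pos, cyc_of_apply_eq (extendInl_inr e τ q)]
      · simp [hN]
      · intro l hl
        exact (hl.eq_of_left (extendInl_inr e τ q)).le

theorem moore_upper_unipotent_conj (h2 : (2 : F) ≠ 0) (e : κ ⊕ κ' ≃ ι)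
    (B : Matrix κ κ' ℍ[F, a, b]) {M : Matrix ι ι ℍ[F, a, b]} (hM : M.IsHermitian) :
    moore ((Matrix.fromBlocks 1 B 0 1).reindex e e * M *
      ((Matrix.fromBlocks 1 B 0 1).reindex e e)ᴴ) = moore M := by
  induction B using Matrix.induction_on' generalizing M with
  | h_zero => simp [Matrix.fromBlocks_one]
  | h_add B C hB hC =>
    have h : (Matrix.fromBlocks (1 : Matrix κ κ ℍ[F, a, b]) (B + C) 0 1).reindex e e =
        (Matrix.fromBlocks 1 B 0 1).reindex e e * (Matrix.fromBlocks 1 C 0 1).reindex e e := by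
      simp only [Matrix.reindex_apply, Matrix.submatrix_mul_equiv, Matrix.fromBlocks_multiply]
      simp [add_comm]
    rw [h, Matrix.conjTranspose_mul, ← hC hM,
      ← hB (Matrix.isHermitian_mul_mul_conjTranspose _ hM)]
    simp only [Matrix.mul_assoc]
  | h_std_basis i j c =>
    have h : (Matrix.fromBlocks (1 : Matrix κ κ ℍ[F, a, b]) (Matrix.single i j c) 0 1).reindex e e =
        1 + Matrix.single (e (Sum.inl i)) (e (Sum.inr j)) c := by
      refine Matrix.ext fun x y => ?_
      obtain ⟨x, rfl⟩ := e.surjective x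
      obtain ⟨y, rfl⟩ := e.surjective y
      rcases x with x | x <;> rcases y with y | y <;>
        simp [Matrix.one_apply, Matrix.single_apply]
    rw [h]
    exact moore_one_add_single_conj h2 hM (by simp) c

theorem moore_bordered (h2 : (2 : F) ≠ 0) (e : κ ⊕ κ' ≃ ι)
    (he : ∀ p q, e (Sum.inl p) ≤ e (Sum.inl q) ↔ p ≤ q) (A : Matrix κ κ' ℍ[F, a, b]) :
    moore ((Matrix.fromBlocks 0 A Aᴴ (-1)).reindex e e) =
      (-1) ^ Fintype.card κ' * moore (A * Aᴴ) := by
  have hH : ((Matrix.fromBlocks (A * Aᴴ) 0 0 (-1)).reindex e e).IsHermitian := by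
    rw [Matrix.IsHermitian, Matrix.conjTranspose_reindex, Matrix.fromBlocks_conjTranspose]
    simp
  rw [← moore_blockDiagonal_neg_one e he, ← moore_upper_unipotent_conj h2 e (-A) hH]
  congr 1
  rw [Matrix.conjTranspose_reindex, Matrix.fromBlocks_conjTranspose]
  simp only [Matrix.reindex_apply, Matrix.submatrix_mul_equiv, Matrix.fromBlocks_multiply]
  simp

theorem moore_antiblock (e : κ ⊕ κ ≃ ι) (B C D : Matrix κ κ ℍ[F, a, b]) :
    moore ((Matrix.fromBlocks 0 B C D).reindex e e) =
      moore ((Matrix.fromBlocks 0 B C 0).reindex e e) := by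
  rw [moore, moore]
  refine Finset.sum_congr rfl fun σ _ => ?_
  congr 1
  by_cases h : ∃ p q, σ (e (Sum.inl p)) = e (Sum.inl q)
  · obtain ⟨p, q, h⟩ := h
    rw [cyclesRe_eq_zero (p := e (Sum.inl p)), cyclesRe_eq_zero (p := e (Sum.inl p))] <;> simp [h]
  · push Not at h
    have h' : ∀ p, ∃ q, σ (e (Sum.inl p)) = e (Sum.inr q) := fun p => by
      obtain ⟨y, hy⟩ := e.surjective (σ (e (Sum.inl p)))
      rcases y with q | q
      · exact absurd hy.symm (h p q)
      · exact ⟨q, hy.symm⟩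
    choose f hf using h'
    have hinj : Injective f := fun p p' hp => by
      have : σ (e (Sum.inl p)) = σ (e (Sum.inl p')) := by rw [hf, hf, hp]
      simpa using this
    have hsurj := Finite.surjective_of_injective hinj
    refine cyclesRe_congr fun x => ?_
    obtain ⟨x, rfl⟩ := e.surjective x
    rcases x with p | q
    · simp [hf]
    · obtain ⟨y, hy⟩ := e.surjective (σ (e (Sum.inr q)))
      rcases y with p | q'
      · simp [← hy]
      · obtain ⟨p, rfl⟩ := hsurj q'
        rw [← hf] at hy
        simp at hy

end Block

section Gram

variable {κ : Type*} [Fintype κ] [LinearOrder κ] {F : Type*} [Field F] {a b : F}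

theorem moore_mul_conjTranspose_comm (h2 : (2 : F) ≠ 0) (A : Matrix κ κ ℍ[F, a, b]) :
    moore (A * Aᴴ) = moore (Aᴴ * A) := by
  let e : κ ⊕ κ ≃ κ ⊕ₗ κ := toLex
  let e' : κ ⊕ κ ≃ κ ⊕ₗ κ := (Equiv.sumComm κ κ).trans e
  have h1 := moore_bordered h2 e (fun p q => Sum.Lex.inl_le_inl_iff) A
  have h3 := moore_bordered h2 e' (fun p q => Sum.Lex.inr_le_inr_iff) Aᴴ
  have h4 : (Matrix.fromBlocks 0 Aᴴ A 0).reindex e' e' =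
      (Matrix.fromBlocks 0 A Aᴴ 0).reindex e e := by
    refine Matrix.ext fun x y => ?_
    obtain ⟨x, rfl⟩ := e.surjective x
    obtain ⟨y, rfl⟩ := e.surjective y
    rcases x with x | x <;> rcases y with y | y <;> simp [e']
  rw [moore_antiblock] at h1 h3
  rw [Matrix.conjTranspose_conjTranspose, h4, h1] at h3
  exact mul_left_cancel₀ (pow_ne_zero _ (neg_ne_zero.mpr one_ne_zero)) h3

end Gram

section RowColumn

variable {F : Type*} [Field F] {a b : F}

theorem prod_map_filter_eq {α H : Type*} [Monoid H] (l : List α) (P : α → Prop)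
    [DecidablePred P] (f : α → H) :
    ((l.filter fun x => P x).map f).prod = (l.map fun x => if P x then f x else 1).prod := by
  induction l with
  | nil => simp
  | cons x l ih => by_cases h : P x <;> simp [h, ih]

open Classical in
theorem sum_mul_prod_cyc_eq {ι : Type*} [Fintype ι] [LinearOrder ι] (h2 : (2 : F) ≠ 0)
    {M : Matrix ι ι ℍ[F, a, b]} {i : ι}
    (hM : ∀ p q, p ≠ i → q ≠ i → star (M p q) = M q p) (l : List ι) (hl : l.Nodup)
    (W : Equiv.Perm ι → ℍ[F, a, b])
    (hW : ∀ k ∈ l, ∀ σ : Equiv.Perm ι, ¬ σ.SameCycle i k → W (revCycle σ k) = W σ) :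
    ∑ σ, W σ *
        (l.map fun p => if IsLead σ p ∧ ¬ σ.SameCycle i p then cyc M σ p else 1).prod =
      ∑ σ, W σ * (l.map fun p => algebraMap F ℍ[F, a, b] (leadFactor M σ i p)).prod := by
  have hM' : ∀ {σ : Equiv.Perm ι} {k : ι}, ¬ σ.SameCycle i k →
      ∀ p q, σ.SameCycle k p → σ.SameCycle k q → star (M p q) = M q p := fun h p q hp hq =>
    hM p q (fun h' => h (h' ▸ hp.symm)) (fun h' => h (h' ▸ hq.symm))
  induction l generalizing W with
  | nil => simp
  | cons k l ih =>
    rw [List.nodup_cons] at hl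
    have ih' := ih hl.2 (fun σ => W σ * algebraMap F ℍ[F, a, b] (leadFactor M σ i k))
      fun m hm σ hσ => by
        rw [hW m (List.mem_cons_of_mem _ hm) σ hσ, leadFactor_revCycle hM']
    simp only [List.map_cons, List.prod_cons, ← mul_assoc]
    rw [← ih', ← Finset.sum_filter_add_sum_filter_not _
      (fun σ : Equiv.Perm ι => IsLead σ k ∧ ¬ σ.SameCycle i k)]
    conv_rhs => rw [← Finset.sum_filter_add_sum_filter_not _
      (fun σ : Equiv.Perm ι => IsLead σ k ∧ ¬ σ.SameCycle i k)]
    congr 1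
    · have key := sum_mul_mul_eq_sum_re h2
        (Finset.univ.filter fun σ : Equiv.Perm ι => IsLead σ k ∧ ¬ σ.SameCycle i k)
        (fun σ => revCycle σ k) (fun σ => revCycle_revCycle σ k)
        (fun σ hσ => by simpa [sameCycle_revCycle, isLead_revCycle] using hσ) W
        (fun σ => cyc M σ k) (fun σ =>
          (l.map fun p => if IsLead σ p ∧ ¬ σ.SameCycle i p then cyc M σ p else 1).prod)
        (fun σ hσ => hW k List.mem_cons_self σ (Finset.mem_filter.mp hσ).2.2)
        (fun σ hσ => by
          have hσ := (Finset.mem_filter.mp hσ).2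
          simp only [sameCycle_revCycle, isLead_revCycle]
          congr 1
          refine List.map_congr_left fun p hp => ?_
          by_cases h : IsLead σ p ∧ ¬ σ.SameCycle i p
          · rw [if_pos h, if_pos h, cyc_revCycle_of_not_sameCycle]
            intro h'
            exact hl.1 (hσ.1.eq_of_sameCycle h.1 h' ▸ hp)
          · rw [if_neg h, if_neg h])
        (fun σ hσ => cyc_revCycle_of_sameCycle (hM' (Finset.mem_filter.mp hσ).2.2)
          (SameCycle.refl σ k))
      refine Eq.trans (Finset.sum_congr rfl fun σ hσ => ?_)
        (key.trans (Finset.sum_congr rfl fun σ hσ => ?_))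
      · rw [if_pos (Finset.mem_filter.mp hσ).2]
      · rw [leadFactor, if_pos (Finset.mem_filter.mp hσ).2]
    · refine Finset.sum_congr rfl fun σ hσ => ?_
      have hσ := (Finset.mem_filter.mp hσ).2
      rw [if_neg hσ, leadFactor, if_neg hσ, map_one]

theorem rdet_eq_mooreRow (h2 : (2 : F) ≠ 0) {n : ℕ} {i : Fin n}
    {M : Matrix (Fin n) (Fin n) ℍ[F, a, b]}
    (hM : ∀ p q, p ≠ i → q ≠ i → star (M p q) = M q p) : rdet i M = mooreRow i M := by
  classical
  have key := sum_mul_prod_cyc_eq h2 hM (List.finRange n) (List.nodup_finRange n)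
    (fun σ => (((sign σ : ℤˣ) : ℤ) : ℍ[F, a, b]) * cyc M σ i) fun k _ σ hσ => by
      rw [sign_revCycle, cyc_revCycle_of_not_sameCycle M fun h => hσ h.symm]
  rw [rdet, mooreRow]
  refine Eq.trans (Finset.sum_congr rfl fun σ _ => ?_)
    (key.trans (Finset.sum_congr rfl fun σ _ => ?_))
  · rw [zsmul_eq_mul, mul_assoc, leaders, ← prod_map_filter_eq]
    congr 3
    refine congrArg (List.map (cyc M σ)) (List.filter_congr fun m _ => ?_)
    simp [IsLead, and_comm]
  · rw [zsmul_eq_mul, mul_assoc, Fin.prod_univ_def, map_list_prod, List.map_map]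
    rfl

theorem cdet_eq_star_rdet {n : ℕ} {H : Type*} [Ring H] [StarRing H] (j : Fin n)
    (M : Matrix (Fin n) (Fin n) H) : cdet j M = star (rdet j Mᴴ) := by
  have hcyc : ∀ (σ : Equiv.Perm (Fin n)) m,
      cycleProd M σ⁻¹ m = star (cycleProd Mᴴ σ m) := fun σ m => by
    have := star_cyc Mᴴ σ m
    rw [Matrix.conjTranspose_conjTranspose] at this
    exact this.symm
  have hlead : ∀ σ : Equiv.Perm (Fin n), leaders σ⁻¹ j = leaders σ j := fun σ => by
    simp only [leaders, sameCycle_inv]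
  have hprod : ∀ (l : List (Fin n)) (f : Fin n → H),
      star (l.map f).prod = (l.reverse.map fun m => star (f m)).prod := fun l f => by
    induction l with
    | nil => simp
    | cons x l ih => simp [ih]
  rw [cdet, rdet, star_sum]
  refine Fintype.sum_equiv (Equiv.inv _) _ _ fun σ => ?_
  obtain ⟨σ, rfl⟩ := inv_surjective σ
  rw [funext (hcyc σ)]
  simp only [Equiv.inv_apply, inv_inv, sign_inv, hlead, star_zsmul, star_mul, hprod]

theorem rdet_updateRow_vecMul (h2 : (2 : F) ≠ 0) {n : ℕ} {M : Matrix (Fin n) (Fin n) ℍ[F, a, b]}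
    (hM : M.IsHermitian) (x : Fin n → ℍ[F, a, b]) (i : Fin n) :
    rdet i (M.updateRow i (x ᵥ* M)) = moore M • x i := by
  rw [rdet_eq_mooreRow h2, Matrix.vecMul_eq_sum]
  · refine (mooreRow_updateRow_sum i M Finset.univ x fun k => M k).trans ?_
    rw [Finset.sum_eq_single i, Matrix.updateRow_eq_self, mooreRow_eq_moore h2 hM,
      ← Algebra.commutes, ← Algebra.smul_def]
    · intro k _ hk
      rw [mooreRow_updateRow_eq_zero h2 hM hk, mul_zero]
    · simp
  · intro p q hp hq
    rw [Matrix.updateRow_ne hp, Matrix.updateRow_ne hq]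
    exact hM.apply q p

theorem cdet_updateCol_mulVec (h2 : (2 : F) ≠ 0) {n : ℕ} {M : Matrix (Fin n) (Fin n) ℍ[F, a, b]}
    (hM : M.IsHermitian) (x : Fin n → ℍ[F, a, b]) (j : Fin n) :
    cdet j (M.updateCol j (M *ᵥ x)) = moore M • x j := by
  have h : (M.updateCol j (M *ᵥ x))ᴴ = M.updateRow j (star x ᵥ* M) := by
    rw [← Matrix.updateRow_conjTranspose, Matrix.star_mulVec, hM.eq]
  rw [cdet_eq_star_rdet, h, rdet_updateRow_vecMul h2 hM, Pi.star_apply, QuaternionAlgebra.star_smul',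
    star_star]

theorem rdet_eq_moore (h2 : (2 : F) ≠ 0) {n : ℕ} {M : Matrix (Fin n) (Fin n) ℍ[F, a, b]}
    (hM : M.IsHermitian) (i : Fin n) : rdet i M = algebraMap F ℍ[F, a, b] (moore M) := by
  rw [rdet_eq_mooreRow h2 fun p q _ _ => hM.apply q p, mooreRow_eq_moore h2 hM]

theorem isUnit_of_moore_ne_zero (h2 : (2 : F) ≠ 0) {n : ℕ}
    {A : Matrix (Fin n) (Fin n) ℍ[F, a, b]} (hA : moore (A * Aᴴ) ≠ 0) : IsUnit A := by
  have hH := Matrix.isHermitian_mul_conjTranspose_self A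
  have hinj : Injective (fun x : Fin n → ℍ[F, a, b] => x ᵥ* (A * Aᴴ)) := fun x y hxy => by
    funext i
    apply smul_right_injective _ hA
    simp only [← rdet_updateRow_vecMul h2 hH]
    rw [show x ᵥ* (A * Aᴴ) = y ᵥ* (A * Aᴴ) from hxy]
  let f : (Fin n → ℍ[F, a, b]) →ₗ[F] (Fin n → ℍ[F, a, b]) :=
    { toFun := fun x => x ᵥ* (A * Aᴴ)
      map_add' := fun x y => Matrix.add_vecMul _ x y
      map_smul' := fun c x => Matrix.smul_vecMul c x _ }
  have hsurj : Surjective f := LinearMap.surjective_of_injective hinj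
  choose B hB using fun i : Fin n => hsurj (Pi.single i 1)
  have hBA : (Matrix.of B) * (A * Aᴴ) = 1 := by
    refine Matrix.ext fun i j => ?_
    have h := congrFun (hB i) j
    rw [Pi.single_apply] at h
    rw [Matrix.one_apply, Matrix.mul_apply_eq_vecMul]
    exact h.trans (if_congr eq_comm rfl rfl)
  have : IsNoetherianRing ℍ[F, a, b] := isNoetherian_of_tower F inferInstance
  have hAB := mul_eq_one_comm.mp hBA
  rw [mul_assoc] at hAB
  exact IsUnit.of_mul_eq_one _ hAB

end RowColumn

end RowColDet

end

open RowColDet in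
/-- Cramer's rule for right and left systems over a quaternion algebra `ℍ[F, a, b]`
(`i² = a`, `j² = b`, `ij = k = -ji`), which may be split or a division algebra. The double
determinant is a scalar `d ∈ F`, so dividing by it means multiplying by `d⁻¹`. -/
theorem mainTheorem4 {F : Type*} [Field F] (h2 : (2 : F) ≠ 0) (a b : F) (ha : a ≠ 0) (hb : b ≠ 0)
    (n : ℕ) [NeZero n] (A : Matrix (Fin n) (Fin n) ℍ[F, a, b]) (hA : ddet A ≠ 0) :
    ∃ d : F, ddet A = algebraMap F ℍ[F, a, b] d ∧
      (∀ y : Fin n → ℍ[F, a, b],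
        (∃! x : Fin n → ℍ[F, a, b], A *ᵥ x = y) ∧
        ∀ x : Fin n → ℍ[F, a, b], A *ᵥ x = y →
          ∀ j, x j = d⁻¹ • cdet j ((Aᴴ * A).updateCol j (Aᴴ *ᵥ y))) ∧
      (∀ y : Fin n → ℍ[F, a, b],
        (∃! x : Fin n → ℍ[F, a, b], x ᵥ* A = y) ∧
        ∀ x : Fin n → ℍ[F, a, b], x ᵥ* A = y →
          ∀ i, x i = d⁻¹ • rdet i ((A * Aᴴ).updateRow i (y ᵥ* Aᴴ))) := by
  have hd : ddet A = algebraMap F ℍ[F, a, b] (moore (A * Aᴴ)) :=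
    rdet_eq_moore h2 (Matrix.isHermitian_mul_conjTranspose_self A) 0
  have hd0 : moore (A * Aᴴ) ≠ 0 := fun h => hA (by rw [hd, h, map_zero])
  obtain ⟨U, rfl⟩ := isUnit_of_moore_ne_zero h2 hd0
  refine ⟨_, hd, fun y => ⟨⟨(↑U⁻¹ : Matrix _ _ _) *ᵥ y, ?_, fun x hx => ?_⟩, fun x hx j => ?_⟩,
    fun y => ⟨⟨y ᵥ* (↑U⁻¹ : Matrix _ _ _), ?_, fun x hx => ?_⟩, fun x hx i => ?_⟩⟩
  · beta_reduce
    rw [Matrix.mulVec_mulVec, U.mul_inv, Matrix.one_mulVec]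
  · rw [← hx, Matrix.mulVec_mulVec, U.inv_mul, Matrix.one_mulVec]
  · rw [← hx, Matrix.mulVec_mulVec,
      cdet_updateCol_mulVec h2 (Matrix.isHermitian_conjTranspose_mul_self _),
      ← moore_mul_conjTranspose_comm h2, inv_smul_smul₀ hd0]
  · beta_reduce
    rw [Matrix.vecMul_vecMul, U.inv_mul, Matrix.vecMul_one]
  · rw [← hx, Matrix.vecMul_vecMul, U.mul_inv, Matrix.vecMul_one]
  · rw [← hx, Matrix.vecMul_vecMul,
      rdet_updateRow_vecMul h2 (Matrix.isHermitian_mul_conjTranspose_self _),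
      inv_smul_smul₀ hd0]
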